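/- Let $G$ be a finite directed acyclic graph with vertex set $V$. A \emph{trek} from $i$ to $j$ in $G$ is a simple path $P$ from $i$ to $j$ in the underlying undirected graph that does not contain two distinct edges $x\to z$, $y\to z$ with the same head; it goes up, against the direction of the edges, from $i$ to a unique topmost vertex $\mathrm{top}(P)$ and then down to $j$. The vertices of $P$ between $i$ and $\mathrm{top}(P)$ form its $i$-side and those between $\mathrm{top}(P)$ and $j$ form its $j$-side; $\mathrm{top}(P)$ belongs to both sides. For $i=j$ the only trek is the empty one. Let $\phi_G:\mathbb{C}[\sigma_{ij}\mid i,j\in V]\to\mathbb{C}[a_v,\lambda_{kl}\mid v\in V,\ k\to l \text{ an edge of } G]$, where $\sigma_{ij}=\sigma_{ji}$, be the $\mathbb{C}$-algebra homomorphism with $$\phi_G(\sigma_{ij})=\sum_{P \text{ a trek from } i \text{ to } j} a_{\mathrm{top}(P)}\prod_{k\to l\,\in P}\lambda_{kl}.$$ Put $I_G=\ker\phi_G$ and, for a set $O\subseteq V$ of observed vertices, $I_{G,O}=I_G\cap\mathbb{C}[\sigma_{ij}\mid i,j\in O]$. A vertex $c$ is a \emph{choke point} between sets $I,J\subseteq V$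 if every trek from a point of $I$ to a point of $J$ contains $c$ and either $c$ is on the $I$-side of all these treks or $c$ is on the $J$-side of all these treks. Let $T$ be a rooted directed tree, that is, a finite directed acyclic graph whose underlying undirected graph is a tree and all of whose edges are directed away from a given root vertex, and let $O$ be the set of leaves of $T$ (the vertices without children). Then $I_{T,O}$ is the ideal of $\mathbb{C}[\sigma_{ij}\mid i,j\in O]$ generated by the quadratic tetrads $$\sigma_{ik}\sigma_{jl}-\sigma_{il}\sigma_{kj}$$ with $i,j,k,l\in O$ (not necessarily distinct) such that there is a choke point in $T$ between $\{i,j\}$ and $\{k,l\}$. -/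

import Mathlib

open MvPolynomial

noncomputable section

namespace GaussianNetwork

variable {V : Type*}

/-- No directed cycles (in particular no loops and no pair of opposite edges). -/
def IsAcyclic (G : Digraph V) : Prop :=
  ∀ v, ¬ Relation.TransGen G.Adj v v

/-- A directed tree with root `r`: a directed acyclic graph whose underlying undirected graph is a
tree and all of whose edges point away from `r`. -/
structure IsRootedDirectedTree (G : Digraph V) (r : V) : Prop where
  acyclic : IsAcyclic G
  isTree : G.toSimpleGraphInclusive.IsTree
  away : ∀ u v, G.Adj u v →
    G.toSimpleGraphInclusive.dist r v = G.toSimpleGraphInclusive.dist r u + 1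

/-- The leaves of a rooted directed tree: the vertices without children. -/
def leaves (G : Digraph V) : Set V := {v | ∀ w, ¬ G.Adj v w}

/-- A path contains a collider if it uses two different edges `x → z` and `y → z` with the same
head. -/
def HasCollider (G : Digraph V) {i j : V} (p : G.toSimpleGraphInclusive.Walk i j) : Prop :=
  ∃ x y z, x ≠ y ∧ G.Adj x z ∧ G.Adj y z ∧ s(x, z) ∈ p.edges ∧ s(y, z) ∈ p.edges

/-- The treks from `i` to `j`: simple paths (of any edge directions) without a collider. -/
def Trek (G : Digraph V) (i j : V) : Type _ :=
  {p : G.toSimpleGraphInclusive.Walk i j // p.IsPath ∧ ¬ HasCollider G p}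

namespace Trek

variable {G : Digraph V} {i j : V}

/-- `c` lies on the `i`-side of the trek `P` from `i` to `j`: going along `P` from `i` to `c`, every
edge is traversed upwards, against its direction. The top of `P` lies on both sides. -/
def OnLeftSide (P : Trek G i j) (c : V) : Prop :=
  ∃ (p : G.toSimpleGraphInclusive.Walk i c) (q : G.toSimpleGraphInclusive.Walk c j),
    P.1 = p.append q ∧ ∀ d ∈ p.darts, G.Adj d.snd d.fst

/-- `c` lies on the `j`-side of the trek `P` from `i` to `j`: going along `P` from `c` to `j`, every
edge is traversed downwards, in its direction. The top of `P` lies on both sides. -/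
def OnRightSide (P : Trek G i j) (c : V) : Prop :=
  ∃ (p : G.toSimpleGraphInclusive.Walk i c) (q : G.toSimpleGraphInclusive.Walk c j),
    P.1 = p.append q ∧ ∀ d ∈ q.darts, G.Adj d.fst d.snd

/-- `t` is the topmost vertex of `P`: the trek goes up from `i` to `t` and then down to `j`. -/
def IsTop (P : Trek G i j) (t : V) : Prop :=
  P.OnLeftSide t ∧ P.OnRightSide t

/-- The topmost vertex of a trek; in an acyclic graph it exists and is unique, see
`existsUnique_isTop`. -/
def top (P : Trek G i j) : V :=
  @Classical.epsilon V ⟨i⟩ P.IsTop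

/-- The same trek, traversed from `j` to `i`. -/
def reverse (P : Trek G i j) : Trek G j i :=
  ⟨P.1.reverse, P.2.1.reverse, fun ⟨x, y, z, h⟩ => P.2.2 ⟨x, y, z, by simpa using h⟩⟩

theorem reverse_reverse (P : Trek G i j) : P.reverse.reverse = P :=
  Subtype.ext (SimpleGraph.Walk.reverse_reverse _)

theorem OnLeftSide.reverse {P : Trek G i j} {c : V} (h : P.OnLeftSide c) :
    P.reverse.OnRightSide c := by
  obtain ⟨p, q, h1, h2⟩ := h
  refine ⟨q.reverse, p.reverse, ?_, ?_⟩
  · change P.1.reverse = _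
    rw [h1, SimpleGraph.Walk.reverse_append]
  · intro d hd
    simpa using h2 d.symm (by simpa using hd)

theorem OnRightSide.reverse {P : Trek G i j} {c : V} (h : P.OnRightSide c) :
    P.reverse.OnLeftSide c := by
  obtain ⟨p, q, h1, h2⟩ := h
  refine ⟨q.reverse, p.reverse, ?_, ?_⟩
  · change P.1.reverse = _
    rw [h1, SimpleGraph.Walk.reverse_append]
  · intro d hd
    simpa using h2 d.symm (by simpa using hd)

theorem isTop_reverse (P : Trek G i j) : P.reverse.IsTop = P.IsTop := by
  funext t
  refine propext ⟨fun h => ?_, fun h => ⟨h.2.reverse, h.1.reverse⟩⟩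
  have h' : P.reverse.reverse.IsTop t := ⟨h.2.reverse, h.1.reverse⟩
  rwa [reverse_reverse] at h'

theorem top_reverse (P : Trek G i j) : P.reverse.top = P.top := by
  unfold top
  rw [isTop_reverse]

instance instFinite [Finite V] : Finite (Trek G i j) := by
  classical
  have := Fintype.ofFinite V
  exact Finite.of_injective
    (fun P : Trek G i j => (⟨P.1, P.2.1⟩ : G.toSimpleGraphInclusive.Path i j))
    (fun P Q h => Subtype.ext (show P.1 = Q.1 from Subtype.mk.inj h))

instance instFintype [Finite V] : Fintype (Trek G i j) := Fintype.ofFinite _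

end Trek

/-- In an acyclic graph every trek has exactly one topmost vertex. -/
theorem existsUnique_isTop {G : Digraph V} (hG : IsAcyclic G) {i j : V} (P : Trek G i j) :
    ∃! t, P.IsTop t := by
  have asymm : ∀ {u v : V}, G.Adj u v → ¬ G.Adj v u := fun h h' =>
    hG _ ((Relation.TransGen.single h).tail h')
  obtain ⟨p, hp, hc⟩ := P
  induction p with
  | nil =>
    refine ⟨_, ⟨⟨.nil, .nil, rfl, by simp⟩, ⟨.nil, .nil, rfl, by simp⟩⟩, ?_⟩
    rintro t ⟨⟨q, s, h, -⟩, -⟩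
    cases q with
    | nil => rfl
    | cons h' q => simp at h
  | @cons u v w h p ih =>
    have hp' := SimpleGraph.Walk.cons_isPath_iff h p |>.1 hp
    have hc' : ¬ HasCollider G p := fun ⟨x, y, z, h1, h2, h3, h4, h5⟩ =>
      hc ⟨x, y, z, h1, h2, h3, by simp [h4], by simp [h5]⟩
    obtain ⟨t, ⟨ht1, ht2⟩, hu⟩ := ih hp'.1 hc'
    rcases h.2 with huv | hvu
    · -- The first edge goes down, so the top is `u`.
      refine ⟨u, ⟨⟨.nil, _, rfl, by simp⟩, ⟨.nil, _, rfl, ?_⟩⟩, ?_⟩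
      · have htv : t = v := by
          obtain ⟨q, s, hq, hd⟩ := ht1
          cases q with
          | nil => rfl
          | @cons _ x _ h' q =>
            exfalso
            have hq : p = .cons h' (q.append s) := hq
            have hxv : G.Adj x v := hd ⟨(v, x), h'⟩ (by simp)
            refine hc ⟨u, x, v, ?_, huv, hxv, by simp, ?_⟩
            · rintro rfl
              exact hp'.2 (by rw [hq]; simp)
            · rw [hq, Sym2.eq_swap]; simp
        subst htv
        obtain ⟨q, s, hq, hd⟩ := ht2
        have hqn : q = .nil := by
          have h1 : q.IsPath := by
            have := hp'.1
            change p = _ at hq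
            rw [hq] at this
            exact this.of_append_left
          exact SimpleGraph.Walk.eq_nil_iff_nil.2 (SimpleGraph.Walk.isPath_iff_nil.1 h1)
        subst hqn
        have hq : p = s := hq
        subst hq
        intro d hd'
        rw [SimpleGraph.Walk.darts_cons, List.mem_cons] at hd'
        rcases hd' with rfl | hd'
        · exact huv
        · exact hd d hd'
      · rintro t' ⟨⟨q, s, hq, hd⟩, -⟩
        cases q with
        | nil => rfl
        | @cons _ x _ h' q =>
          have hq : SimpleGraph.Walk.cons h p = .cons h' (q.append s) := hq
          have hx : v = x := (SimpleGraph.Walk.cons.inj hq).1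
          subst hx
          exact absurd (hd ⟨(u, v), h'⟩ (by simp)) (asymm huv)
    · refine ⟨t, ⟨?_, ?_⟩, ?_⟩
      · obtain ⟨q, s, hq, hd⟩ := ht1
        have hq : p = q.append s := hq
        refine ⟨.cons h q, s, congrArg (SimpleGraph.Walk.cons h) hq, ?_⟩
        intro d hd'
        rw [SimpleGraph.Walk.darts_cons, List.mem_cons] at hd'
        rcases hd' with rfl | hd'
        · exact hvu
        · exact hd d hd'
      · obtain ⟨q, s, hq, hd⟩ := ht2
        have hq : p = q.append s := hq
        exact ⟨.cons h q, s, congrArg (SimpleGraph.Walk.cons h) hq, hd⟩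
      · rintro t' ⟨⟨q, s, hq, hd⟩, ⟨q', s', hq', hd'⟩⟩
        have key : Trek.OnRightSide (⟨p, hp'.1, hc'⟩ : Trek G v w) t' := by
          cases q' with
          | nil =>
            have hq' : SimpleGraph.Walk.cons h p = s' := hq'
            subst hq'
            exact absurd (hd' ⟨(u, v), h⟩ (by simp)) (asymm hvu)
          | @cons _ x _ h' q' =>
            have hq' : SimpleGraph.Walk.cons h p = .cons h' (q'.append s') := hq'
            obtain ⟨hx, hy⟩ := SimpleGraph.Walk.cons.inj hq'
            subst hx
            exact ⟨q', s', eq_of_heq hy, hd'⟩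
        refine hu t' ⟨?_, key⟩
        cases q with
        | nil =>
          exfalso
          obtain ⟨q1, s1, h1, -⟩ := key
          have h1 : p = q1.append s1 := h1
          exact hp'.2 (by rw [h1]; simp)
        | @cons _ x _ h' q =>
          have hq : SimpleGraph.Walk.cons h p = .cons h' (q.append s) := hq
          obtain ⟨hx, hy⟩ := SimpleGraph.Walk.cons.inj hq
          subst hx
          exact ⟨q, s, eq_of_heq hy, fun d hd1 => hd d (by simp [hd1])⟩

/-- The directed edges of `G`. -/
abbrev Edge (G : Digraph V) : Type _ := {e : V × V // G.Adj e.1 e.2}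

/-- The ring `ℂ[a, λ]`: one indeterminate `a_v` for each vertex and one indeterminate `λ_{kl}` for
each edge `k → l`. -/
abbrev ParamRing (G : Digraph V) : Type _ := MvPolynomial (V ⊕ Edge G) ℂ

/-- The monomial of a trek `P`: the product of `a_{top(P)}` and of all `λ_{kl}` with `k → l` an edge
of `P`. -/
def trekMonomial [Fintype V] {G : Digraph V} {i j : V} (P : Trek G i j) : ParamRing G :=
  open Classical in
  X (Sum.inl P.top) * ∏ e : Edge G with s(e.1.1, e.1.2) ∈ P.1.edges, X (Sum.inr e)

/-- The polynomial `σ_{ij}(a, λ)`, the sum of the monomials of all treks from `i` to `j`. -/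
def trekPolynomial [Fintype V] (G : Digraph V) (i j : V) : ParamRing G :=
  ∑ P : Trek G i j, trekMonomial P

theorem trekPolynomial_comm [Fintype V] (G : Digraph V) (i j : V) :
    trekPolynomial G i j = trekPolynomial G j i := by
  unfold trekPolynomial
  refine Fintype.sum_equiv
    ⟨Trek.reverse, Trek.reverse, Trek.reverse_reverse, Trek.reverse_reverse⟩ _ _ fun P => ?_
  simp only [Equiv.coe_fn_mk, trekMonomial, Trek.top_reverse]
  classical
  congr 1
  refine Finset.prod_congr (Finset.filter_congr fun e _ => ?_) fun _ _ => rfl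
  change _ ↔ _ ∈ P.1.reverse.edges
  rw [SimpleGraph.Walk.edges_reverse, List.mem_reverse]

/-- The trek rule homomorphism `φ_G : ℂ[σ] → ℂ[a, λ]`, sending `σ_{ij}` to `σ_{ij}(a, λ)`. The
indeterminates `σ_{ij} = σ_{ji}` are indexed by unordered pairs (with `i = j` allowed). -/
def trekHom [Fintype V] (G : Digraph V) : MvPolynomial (Sym2 V) ℂ →ₐ[ℂ] ParamRing G :=
  aeval (Sym2.lift ⟨trekPolynomial G, trekPolynomial_comm G⟩)

/-- The ideal `I_G = ker φ_G` of the Gaussian Bayesian network of `G`. -/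
def networkIdeal [Fintype V] (G : Digraph V) : Ideal (MvPolynomial (Sym2 V) ℂ) :=
  RingHom.ker (trekHom G)

/-- The ideal `I_{G,O} = I_G ∩ ℂ[σ_{ij} | i, j ∈ O]` of the network with observed vertices `O`, as an
ideal of the polynomial ring in the `σ_{ij}` with `i, j ∈ O`. -/
def observedIdeal [Fintype V] (G : Digraph V) (O : Set V) : Ideal (MvPolynomial (Sym2 O) ℂ) :=
  (networkIdeal G).comap (rename (Sym2.map ((↑) : O → V)) :
    MvPolynomial (Sym2 O) ℂ →ₐ[ℂ] MvPolynomial (Sym2 V) ℂ)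

/-- `c` is a choke point between `I` and `J`: every trek from a point of `I` to a point of `J`
contains `c`, and either `c` is on the `I`-side of all of them or on the `J`-side of all of them. -/
def IsChokePoint (G : Digraph V) (c : V) (I J : Set V) : Prop :=
  (∀ i ∈ I, ∀ j ∈ J, ∀ P : Trek G i j, c ∈ P.1.support) ∧
    ((∀ i ∈ I, ∀ j ∈ J, ∀ P : Trek G i j, P.OnLeftSide c) ∨
      (∀ i ∈ I, ∀ j ∈ J, ∀ P : Trek G i j, P.OnRightSide c))

/-- The tetrad `σ_{ik} σ_{jl} - σ_{il} σ_{kj}`. -/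
def tetrad {O : Type*} (i j k l : O) : MvPolynomial (Sym2 O) ℂ :=
  X s(i, k) * X s(j, l) - X s(i, l) * X s(k, j)

end GaussianNetwork

end

/-! A rooted directed tree has exactly one trek between two vertices, so the trek rule sends each
`σ_{ij}` to a single monomial. The kernel on the leaf variables is therefore spanned by differences
of monomials with equal image (`ker_le_of_monomial`), and it remains to connect such monomials by
tetrads. A monomial is treated as a multiset `M` of pairs of leaves, that is, a multigraph on the
leaves.

Equal images say two things that suffice: the exponent of `λ` on the edge above `w` counts the pairs
of `M` with exactly one end below `w`, and the exponent of `a_v` at a leaf `v` counts the loops at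
`v`. The exponents of `a` at inner vertices are not needed.

Given `M` and `M'` with equal image, a common loop can be cancelled. Without loops, take a lowest
vertex `v` with some pair `{i, j}`, say of `M'`, below it. Collapsing the leaves to their branches
at `v` gives multigraphs with equal degrees. One or two exchanges of ends then produce `{i, j}` in
`M` (`exists_exchange`), and each exchange is a tetrad with choke point `v` (`swap_mem`). Cancelling
this common factor lowers the degree of the image, and induction finishes (`mon_sub_mon_mem`).
Conversely, a choke point factors the monomials of all four treks, which makes the tetrad vanish
(`observedHom_tetrad`). -/

noncomputable section

namespace GaussianNetwork

variable {V : Type*} {T : Digraph V} {r : V}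

/-! ### Descendants, paths and treks in a rooted directed tree. -/

/-- The descendants of `w`, including `w` itself. -/
def descendants (T : Digraph V) (w : V) : Set V := {x | Relation.ReflTransGen T.Adj w x}

theorem self_mem_descendants (w : V) : w ∈ descendants T w := Relation.ReflTransGen.refl

theorem mem_descendants_of_adj {w x y : V} (hx : x ∈ descendants T w) (h : T.Adj x y) :
    y ∈ descendants T w := Relation.ReflTransGen.tail hx h

theorem descendants_subset {v w : V} (h : w ∈ descendants T v) :
    descendants T w ⊆ descendants T v := fun _ hx => Relation.ReflTransGen.trans h hx

theorem IsAcyclic.notMem_descendants (hT : IsAcyclic T) {u w : V} (h : T.Adj u w) :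
    u ∉ descendants T w := fun hu => hT u (Relation.TransGen.head' h hu)

theorem exists_child_of_mem_descendants {v x : V} (hx : x ∈ descendants T v) (hne : x ≠ v) :
    ∃ w, T.Adj v w ∧ x ∈ descendants T w := by
  rcases Relation.ReflTransGen.cases_head hx with rfl | ⟨w, h, hw⟩
  · exact absurd rfl hne
  · exact ⟨w, h, hw⟩

theorem exists_parent_of_mem_descendants {v x : V} (hx : x ∈ descendants T v) (hne : x ≠ v) :
    ∃ u, T.Adj u x ∧ u ∈ descendants T v := by
  rcases Relation.ReflTransGen.cases_tail hx with rfl | ⟨w, h, hw⟩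
  · exact absurd rfl hne
  · exact ⟨w, hw, h⟩

theorem eq_of_mem_descendants_leaf {v x : V} (hv : v ∈ leaves T) (hx : x ∈ descendants T v) :
    x = v := by
  by_contra hne
  obtain ⟨w, h, -⟩ := exists_child_of_mem_descendants hx hne
  exact hv w h

theorem mem_descendants_of_upward {x c : V} (p : T.toSimpleGraphInclusive.Walk x c)
    (hp : ∀ d ∈ p.darts, T.Adj d.snd d.fst) : x ∈ descendants T c := by
  induction p with
  | nil => exact self_mem_descendants _
  | cons h p ih =>
    refine mem_descendants_of_adj (ih fun d hd => hp d (by simp [hd])) ?_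
    exact hp ⟨(_, _), h⟩ (by simp)

namespace IsRootedDirectedTree

theorem path_unique (hT : IsRootedDirectedTree T r) {i j : V}
    {p q : T.toSimpleGraphInclusive.Walk i j} (hp : p.IsPath) (hq : q.IsPath) : p = q :=
  (hT.isTree.existsUnique_path i j).unique hp hq

/-- A geodesic from `r` to a parent of `z` cannot pass through `z`, which is farther from `r`, so
appending the edge to `z` gives a path. The path from `r` to `z` is unique, hence so is its
penultimate vertex. -/
theorem parent_unique (hT : IsRootedDirectedTree T r) {x y z : V} (hx : T.Adj x z)
    (hy : T.Adj y z) : x = y := by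
  classical
  have key : ∀ x, T.Adj x z → ∃ (p : T.toSimpleGraphInclusive.Walk r x)
      (h : T.toSimpleGraphInclusive.Adj x z), (p.concat h).IsPath := by
    intro x hx
    obtain ⟨p, hp, hl⟩ := hT.isTree.connected.exists_path_of_dist r x
    have hd := hT.away x z hx
    have hne : x ≠ z := by rintro rfl; omega
    refine ⟨p, ⟨hne, Or.inl hx⟩, hp.concat (fun hz => ?_) _⟩
    have h1 := p.length_takeUntil_le_length hz
    have h2 := SimpleGraph.dist_le (p.takeUntil z hz)
    omega
  obtain ⟨p, hp, hp'⟩ := key x hx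
  obtain ⟨q, hq, hq'⟩ := key y hy
  exact (SimpleGraph.Walk.concat_inj (hT.path_unique hp' hq')).1

theorem not_adj_root (hT : IsRootedDirectedTree T r) (x : V) : ¬ T.Adj x r := by
  intro h
  have := hT.away x r h
  simp at this

theorem mem_descendants_root (hT : IsRootedDirectedTree T r) (x : V) : x ∈ descendants T r := by
  obtain ⟨p⟩ := hT.isTree.connected.preconnected r x
  have key : ∀ {y x : V} (p : T.toSimpleGraphInclusive.Walk y x), y ∈ descendants T r →
      x ∈ descendants T r := by
    intro y x p
    induction p with
    | nil => exact id
    | @cons u v w h p ih =>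
      intro hu
      refine ih ?_
      rcases h.2 with h | h
      · exact mem_descendants_of_adj hu h
      · have hne : u ≠ r := by rintro rfl; exact hT.not_adj_root _ h
        obtain ⟨u', h', hu'⟩ := exists_parent_of_mem_descendants hu hne
        rwa [hT.parent_unique h h']
  exact key p (self_mem_descendants r)

theorem exists_parent (hT : IsRootedDirectedTree T r) {v : V} (hv : v ≠ r) : ∃ u, T.Adj u v := by
  obtain ⟨u, h, -⟩ := exists_parent_of_mem_descendants (hT.mem_descendants_root v) hv
  exact ⟨u, h⟩

/-- Climbing from `x` towards `w₁` through unique parents stays below `w₂`, so `w₁` is below `w₂`.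
If they differed, the parent `v` of `w₁` would also be below its own child `w₂`. -/
theorem disjoint_descendants (hT : IsRootedDirectedTree T r) {v w₁ w₂ x : V} (h₁ : T.Adj v w₁)
    (h₂ : T.Adj v w₂) (hx₁ : x ∈ descendants T w₁) (hx₂ : x ∈ descendants T w₂) : w₁ = w₂ := by
  have key : ∀ {w₁ w₂ x : V}, T.Adj v w₁ → T.Adj v w₂ → x ∈ descendants T w₁ →
      x ∈ descendants T w₂ → w₁ ∈ descendants T w₂ := by
    intro w₁ w₂ x h₁ h₂ hx₁
    induction hx₁ with
    | refl => exact id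
    | @tail b c hb hc ih =>
      intro hc'
      by_cases hcw : c = w₂
      · subst hcw
        obtain rfl := hT.parent_unique hc h₂
        exact absurd hb (hT.acyclic.notMem_descendants h₁)
      · obtain ⟨b', hb', hb''⟩ := exists_parent_of_mem_descendants hc' hcw
        rw [hT.parent_unique hb' hc] at hb''
        exact ih hb''
  by_contra hne
  obtain ⟨u, hu, hu'⟩ := exists_parent_of_mem_descendants (key h₁ h₂ hx₁ hx₂) hne
  rw [hT.parent_unique hu h₁] at hu'
  exact hT.acyclic.notMem_descendants h₂ hu'

/-- An edge `x — y` leaves the set of descendants of `w` only if it is the edge above `w`. -/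
theorem eq_edge_iff (hT : IsRootedDirectedTree T r) {u w x y : V} (huw : T.Adj u w)
    (h : T.toSimpleGraphInclusive.Adj x y) :
    s(u, w) = s(x, y) ↔ ¬ (x ∈ descendants T w ↔ y ∈ descendants T w) := by
  have hu := hT.acyclic.notMem_descendants huw
  have hw := self_mem_descendants (T := T) w
  have key : ∀ {x y : V}, T.Adj x y → x ∉ descendants T w → y ∈ descendants T w →
      s(u, w) = s(x, y) := by
    intro x y h hx hy
    by_cases hyw : y = w
    · subst hyw
      rw [hT.parent_unique h huw]
    · obtain ⟨x', hx', hx''⟩ := exists_parent_of_mem_descendants hy hyw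
      rw [hT.parent_unique hx' h] at hx''
      exact absurd hx'' hx
  constructor
  · intro he
    rcases Sym2.eq_iff.1 he with ⟨rfl, rfl⟩ | ⟨rfl, rfl⟩ <;> tauto
  · intro hne
    rcases h.2 with h | h
    · by_cases hx : x ∈ descendants T w
      · exact absurd ⟨fun _ => mem_descendants_of_adj hx h, fun _ => hx⟩ hne
      · exact key h hx (by tauto)
    · rw [Sym2.eq_swap (a := x)]
      by_cases hy : y ∈ descendants T w
      · exact absurd ⟨fun _ => hy, fun _ => mem_descendants_of_adj hy h⟩ hne
      · exact key h hy (by tauto)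

/-- A path uses the edge above `w` if and only if exactly one of its ends is a descendant
of `w`. -/
theorem mem_edges_iff (hT : IsRootedDirectedTree T r) {u w i j : V} (huw : T.Adj u w)
    {p : T.toSimpleGraphInclusive.Walk i j} (hp : p.IsTrail) :
    s(u, w) ∈ p.edges ↔ ¬ (i ∈ descendants T w ↔ j ∈ descendants T w) := by
  induction p with
  | nil => simp
  | @cons x y z h p ih =>
    rw [SimpleGraph.Walk.isTrail_cons] at hp
    rw [SimpleGraph.Walk.edges_cons, List.mem_cons, ih hp.1, hT.eq_edge_iff huw h]
    -- A trail uses the edge above `w` at most once, so if its first step crosses, the rest does not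
    -- cross again.
    by_cases he : s(u, w) = s(x, y)
    · have h1 := (hT.eq_edge_iff huw h).1 he
      have h2 := hp.2
      rw [← he, ih hp.1] at h2
      tauto
    · rw [hT.eq_edge_iff huw h] at he
      tauto

theorem exists_upward_path (hT : IsRootedDirectedTree T r) {v x : V} (hx : x ∈ descendants T v) :
    ∃ p : T.toSimpleGraphInclusive.Walk x v, p.IsPath ∧ (∀ d ∈ p.darts, T.Adj d.snd d.fst) ∧
      ∀ y ∈ p.support, y ∈ descendants T v := by
  induction hx using Relation.ReflTransGen.head_induction_on with
  | refl => exact ⟨.nil, by simp, by simp, by simp [self_mem_descendants]⟩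
  | @head a b hab hb ih =>
    obtain ⟨p, hp, hd, hs⟩ := ih
    have ha := hT.acyclic.notMem_descendants hab
    have hadj : T.toSimpleGraphInclusive.Adj b a :=
      ⟨fun h => ha (h ▸ self_mem_descendants _), Or.inr hab⟩
    have hba : b ∈ descendants T a := mem_descendants_of_adj (self_mem_descendants a) hab
    refine ⟨p.concat hadj, hp.concat (fun h => ha (hs _ h)) _, ?_, ?_⟩
    · intro d hd'
      rw [SimpleGraph.Walk.darts_concat, List.concat_eq_append, List.mem_append,
        List.mem_singleton] at hd'
      rcases hd' with hd' | rfl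
      · exact hd d hd'
      · exact hab
    · intro y hy
      rw [SimpleGraph.Walk.support_concat, List.mem_append, List.mem_singleton] at hy
      rcases hy with hy | rfl
      · exact descendants_subset hba (hs y hy)
      · exact self_mem_descendants _

theorem onLeftSide_of_mem_descendants (hT : IsRootedDirectedTree T r) {i j c : V}
    (P : Trek T i j) (hc : c ∈ P.1.support) (hi : i ∈ descendants T c) : P.OnLeftSide c := by
  classical
  refine ⟨P.1.takeUntil c hc, P.1.dropUntil c hc, (P.1.take_spec hc).symm, ?_⟩
  obtain ⟨p, hp, hd, -⟩ := hT.exists_upward_path hi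
  rwa [hT.path_unique (P.2.1.takeUntil hc) hp]

theorem onRightSide_of_mem_descendants (hT : IsRootedDirectedTree T r) {i j c : V}
    (P : Trek T i j) (hc : c ∈ P.1.support) (hj : j ∈ descendants T c) : P.OnRightSide c := by
  have hc' : c ∈ P.reverse.1.support := by
    change c ∈ P.1.reverse.support
    simpa using hc
  simpa only [Trek.reverse_reverse] using
    (hT.onLeftSide_of_mem_descendants P.reverse hc' hj).reverse

theorem not_hasCollider (hT : IsRootedDirectedTree T r) {i j : V}
    (p : T.toSimpleGraphInclusive.Walk i j) : ¬ HasCollider T p :=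
  fun ⟨_, _, _, hne, hx, hy, _, _⟩ => hne (hT.parent_unique hx hy)

/-- The only trek between two vertices of a rooted directed tree. -/
def trek (hT : IsRootedDirectedTree T r) (i j : V) : Trek T i j :=
  ⟨(hT.isTree.existsUnique_path i j).choose, (hT.isTree.existsUnique_path i j).choose_spec.1,
    hT.not_hasCollider _⟩

theorem trek_eq (hT : IsRootedDirectedTree T r) {i j : V} (P : Trek T i j) : P = hT.trek i j :=
  Subtype.ext (hT.path_unique P.2.1 (hT.trek i j).2.1)

theorem trekPolynomial_eq [Fintype V] (hT : IsRootedDirectedTree T r) (i j : V) :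
    trekPolynomial T i j = trekMonomial (hT.trek i j) := by
  have : Subsingleton (Trek T i j) := ⟨fun P Q => (hT.trek_eq P).trans (hT.trek_eq Q).symm⟩
  exact Fintype.sum_subsingleton _ _

end IsRootedDirectedTree

/-! ### Branches at a vertex and choke points. -/

/-- The branch at `v` which contains `x`: the child of `v` above `x`, or `v` itself if there is no
such child. -/
def branch (T : Digraph V) (v x : V) : V :=
  open Classical in
  if h : ∃ w, T.Adj v w ∧ x ∈ descendants T w then h.choose else v

theorem branch_eq_self_iff (hT : IsAcyclic T) {v x : V} :
    branch T v x = v ↔ x ∈ descendants T v → x = v := by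
  unfold branch
  split_ifs with h
  · have h' := h.choose_spec
    refine ⟨fun he => ?_, fun hx => ?_⟩
    · rw [he] at h'
      exact absurd (self_mem_descendants v) (hT.notMem_descendants h'.1)
    · obtain rfl := hx (descendants_subset
        (mem_descendants_of_adj (self_mem_descendants v) h'.1) h'.2)
      exact absurd h'.2 (hT.notMem_descendants h'.1)
  · refine ⟨fun _ hx => ?_, fun _ => rfl⟩
    by_contra hne
    exact h (exists_child_of_mem_descendants hx hne)

theorem IsRootedDirectedTree.branch_eq_iff (hT : IsRootedDirectedTree T r) {v w x : V}
    (hw : T.Adj v w) : branch T v x = w ↔ x ∈ descendants T w := by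
  unfold branch
  split_ifs with h
  · have h' := h.choose_spec
    refine ⟨fun he => ?_, fun hx => hT.disjoint_descendants h'.1 hw h'.2 hx⟩
    rw [he] at h'
    exact h'.2
  · refine ⟨?_, fun hx => absurd ⟨w, hw, hx⟩ h⟩
    rintro rfl
    exact absurd (self_mem_descendants _) (hT.acyclic.notMem_descendants hw)

theorem branch_eq_self_or_adj (v x : V) : branch T v x = v ∨ T.Adj v (branch T v x) := by
  unfold branch
  split_ifs with h
  · exact Or.inr h.choose_spec.1
  · exact Or.inl rfl

theorem branch_eq_self_iff_of_leaf (hT : IsAcyclic T) {v x : V} (hv : v ∉ leaves T)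
    (hx : x ∈ leaves T) : branch T v x = v ↔ x ∉ descendants T v := by
  have hne : x ≠ v := by rintro rfl; exact hv hx
  rw [branch_eq_self_iff hT]
  tauto

/-- The path between vertices in different branches at `v` contains `v`. -/
theorem IsRootedDirectedTree.mem_support_of_branch_ne (hT : IsRootedDirectedTree T r) {v i j : V}
    (hne : branch T v i ≠ branch T v j) (P : Trek T i j) : v ∈ P.1.support := by
  have hbr : ∀ x y : V, branch T v x ≠ branch T v y → T.Adj v (branch T v x) →
      ¬ (x ∈ descendants T (branch T v x) ↔ y ∈ descendants T (branch T v x)) := by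
    intro x y hxy h
    rw [← hT.branch_eq_iff h, ← hT.branch_eq_iff h]
    simpa using hxy.symm
  have hv' : ∀ b, T.Adj v b → ¬ (i ∈ descendants T b ↔ j ∈ descendants T b) →
      v ∈ P.1.support := by
    intro b hb h
    exact SimpleGraph.Walk.fst_mem_support_of_mem_edges _
      ((hT.mem_edges_iff hb P.2.1.isTrail).2 h)
  -- Distinct branches are not both `v`, so one of them is a child `b`. Only one end lies below `b`,
  -- hence the path uses the edge from `v` to `b`.
  rcases branch_eq_self_or_adj (T := T) v i with h | h
  · rcases branch_eq_self_or_adj (T := T) v j with h' | h'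
    · exact absurd (h.trans h'.symm) hne
    · exact hv' _ h' (by rw [iff_comm]; exact hbr j i hne.symm h')
  · exact hv' _ h (hbr i j hne h)

/-- A vertex which separates two pairs of leaves is a choke point between them. -/
theorem IsRootedDirectedTree.isChokePoint_of_branch_ne (hT : IsRootedDirectedTree T r)
    {v i j k l : V} (hv : v ∉ leaves T) (hi : i ∈ leaves T) (hj : j ∈ leaves T)
    (hk : k ∈ leaves T) (hl : l ∈ leaves T) (hik : branch T v i ≠ branch T v k)
    (hil : branch T v i ≠ branch T v l) (hjk : branch T v j ≠ branch T v k)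
    (hjl : branch T v j ≠ branch T v l) : IsChokePoint T v {i, j} {k, l} := by
  have hs : ∀ x ∈ ({i, j} : Set V), ∀ y ∈ ({k, l} : Set V), ∀ P : Trek T x y,
      v ∈ P.1.support := by
    rintro x (rfl | rfl) y (rfl | rfl) P <;>
      exact hT.mem_support_of_branch_ne (by assumption) P
  refine ⟨hs, ?_⟩
  by_cases h : i ∈ descendants T v ∧ j ∈ descendants T v
  · refine Or.inl fun x hx y hy P => hT.onLeftSide_of_mem_descendants P (hs x hx y hy P) ?_
    rcases hx with rfl | rfl
    exacts [h.1, h.2]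
  -- Leaves not below `v` all share the upward branch `v`, so such leaves cannot occur in both
  -- pairs.
  · have h' : k ∈ descendants T v ∧ l ∈ descendants T v := by
      have e := fun {x : V} (hx : x ∈ leaves T) => branch_eq_self_iff_of_leaf hT.acyclic hv hx
      by_contra h'
      rw [not_and_or, ← e hi, ← e hj] at h
      rw [not_and_or, ← e hk, ← e hl] at h'
      rcases h with h | h <;> rcases h' with h' | h' <;> have := h.trans h'.symm <;> contradiction
    refine Or.inr fun x hx y hy P => hT.onRightSide_of_mem_descendants P (hs x hx y hy P) ?_
    rcases hy with rfl | rfl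
    exacts [h'.1, h'.2]

end GaussianNetwork

end

noncomputable section

namespace GaussianNetwork

/-! ### Exchanges in multigraphs with prescribed degrees. -/

section Multigraph

variable {O β : Type*}

/-- The pair `p` has exactly one end in `S`. -/
def Cut (S : Set O) (p : Sym2 O) : Prop := ∃ x ∈ S, ∃ y ∉ S, p = s(x, y)

theorem cut_mk_iff {S : Set O} {x y : O} : Cut S s(x, y) ↔ ¬ (x ∈ S ↔ y ∈ S) := by
  constructor
  · rintro ⟨a, ha, b, hb, h⟩
    rcases Sym2.eq_iff.1 h with ⟨rfl, rfl⟩ | ⟨rfl, rfl⟩ <;> tauto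
  · intro h
    by_cases hx : x ∈ S
    · exact ⟨x, hx, y, by tauto, rfl⟩
    · exact ⟨y, by tauto, x, hx, Sym2.eq_swap⟩

open Classical in
/-- The number of pairs in `M` with exactly one end in `S`. -/
def cutCount (S : Set O) (M : Multiset (Sym2 O)) : ℕ := (M.map fun p => if Cut S p then 1 else 0).sum

theorem exists_cut_of_cutCount_eq {S : Set O} {M M' : Multiset (Sym2 O)}
    (h : cutCount S M = cutCount S M') {p : Sym2 O} (hp : p ∈ M') (hc : Cut S p) :
    ∃ q ∈ M, Cut S q := by
  by_contra hn
  push Not at hn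
  have h0 : cutCount S M = 0 := by
    refine Multiset.sum_eq_zero fun n hn' => ?_
    obtain ⟨q, hq, rfl⟩ := Multiset.mem_map.1 hn'
    simp [hn q hq]
  rw [h0] at h
  have := Multiset.sum_eq_zero_iff.1 h.symm _ (Multiset.mem_map_of_mem _ hp)
  simp [hc] at this

open Classical in
-- The handshake count after collapsing along `B`: each edge that does not become a loop contributes
-- to the degrees of its two ends.
theorem sum_cut_fibers [Fintype β] (B : O → β) (x y : O) :
    (∑ b, if Cut (B ⁻¹' {b}) s(x, y) then 1 else 0) = if B x = B y then 0 else 2 := by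
  have h : ∀ b, (Cut (B ⁻¹' {b}) s(x, y)) ↔ ¬ (B x = b ↔ B y = b) := fun b => cut_mk_iff
  split_ifs with hxy
  · exact Finset.sum_eq_zero fun b _ => by rw [h, hxy]; simp
  · rw [← Finset.sum_subset (Finset.subset_univ {B x, B y}), Finset.sum_pair hxy]
    · simp [h, hxy, Ne.symm hxy]
    · intro b _ hb
      simp only [Finset.mem_insert, Finset.mem_singleton, not_or] at hb
      rw [h]
      simp [Ne.symm hb.1, Ne.symm hb.2]

/-- If two loopless multigraphs have the same degrees and one of them has an edge avoiding the
vertex `b`, then so does the other. -/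
theorem exists_pair_avoiding [Fintype β] (B : O → β) {M M' : Multiset (Sym2 O)}
    (h : ∀ b, cutCount (B ⁻¹' {b}) M = cutCount (B ⁻¹' {b}) M') {b : β} {i j : O}
    (hm : s(i, j) ∈ M') (hij : B i ≠ B j) (hi : B i ≠ b) (hj : B j ≠ b) :
    ∃ x y, s(x, y) ∈ M ∧ B x ≠ B y ∧ B x ≠ b ∧ B y ≠ b := by
  classical
  -- Otherwise every non-loop edge of `M` meets `b`, so the degree sum `f` of `M` is at most twice
  -- the degree `g` at `b`. In `M'` the edge `s(i, j)` makes the degree sum strictly larger than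
  -- twice the degree at `b`, although both quantities agree.
  by_contra! hn
  let f : Sym2 O → ℕ := fun p => ∑ b, if Cut (B ⁻¹' {b}) p then 1 else 0
  let g : Sym2 O → ℕ := fun p => if Cut (B ⁻¹' {b}) p then 1 else 0
  have hf : (M.map f).sum = (M'.map f).sum := by
    simp only [f, Multiset.sum_map_sum]
    exact Finset.sum_congr rfl fun b _ => h b
  have hg : (M.map g).sum = (M'.map g).sum := h b
  have hgi : ∀ x y, g s(x, y) = if (B x = b ↔ B y = b) then 0 else 1 := by
    intro x y
    change (if Cut (B ⁻¹' {b}) s(x, y) then 1 else 0) = _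
    simp only [cut_mk_iff]
    rw [ite_not]; rfl
  have h1 : (M.map f).sum ≤ (M.map fun p => 2 * g p).sum := by
    refine Multiset.sum_map_le_sum_map _ _ fun p => ?_
    induction p with | _ x y
    intro hp
    have h2 := hn x y hp
    simp only [f, sum_cut_fibers, hgi]
    split_ifs with h3 h4 <;> simp_all
  have h2 : (M'.map fun p => 2 * g p).sum < (M'.map f).sum := by
    obtain ⟨N, rfl⟩ := Multiset.exists_cons_of_mem hm
    rw [Multiset.map_cons, Multiset.map_cons, Multiset.sum_cons, Multiset.sum_cons]
    refine add_lt_add_of_lt_of_le ?_ (Multiset.sum_map_le_sum_map _ _ fun p => ?_)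
    · simp only [f, sum_cut_fibers, hgi]
      simp [hi, hj, hij]
    · induction p with | _ x y
      intro _
      simp only [f, sum_cut_fibers, hgi]
      split_ifs with h3 h4 <;> simp_all
  rw [Multiset.sum_map_mul_left, hg, hf] at h1
  rw [Multiset.sum_map_mul_left] at h2
  omega

/-- Exchanging the ends of pairs, one can produce a pair of a second multigraph with the same
degrees. -/
theorem exists_exchange [Fintype β] (B : O → β) {M M' : Multiset (Sym2 O)}
    (h : ∀ b, cutCount (B ⁻¹' {b}) M = cutCount (B ⁻¹' {b}) M') {i j k l : O}
    (hm : s(i, j) ∈ M') (hij : B i ≠ B j) (hk : s(i, k) ∈ M) (hik : B i ≠ B k)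
    (hl : s(j, l) ∈ M) (hjl : B j ≠ B l) (R : Multiset (Sym2 O) → Multiset (Sym2 O) → Prop)
    (refl : ∀ M, R M M) (trans : ∀ M N K, R M N → R N K → R M K)
    (swap : ∀ N a b c d, B a ≠ B b → B c ≠ B d → B a ≠ B c → B b ≠ B d →
      R (s(a, b) ::ₘ s(c, d) ::ₘ N) (s(a, c) ::ₘ s(b, d) ::ₘ N)) :
    ∃ N, s(i, j) ∈ N ∧ R M N := by
  classical
  by_cases hkj : k = j
  · subst hkj
    exact ⟨M, hk, refl M⟩
  have hij' : i ≠ j := fun e => hij (e ▸ rfl)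
  have hne : s(j, l) ≠ s(i, k) := by
    rw [Ne, Sym2.eq_iff]
    rintro (⟨e, -⟩ | ⟨e, -⟩)
    exacts [hij' e.symm, hkj e.symm]
  obtain ⟨N, rfl⟩ := Multiset.exists_cons_of_mem hk
  obtain ⟨N, rfl⟩ := Multiset.exists_cons_of_mem ((Multiset.mem_cons.1 hl).resolve_left hne)
  by_cases hkl : B k = B l
  -- A direct exchange would create a loop at `B k = B l`. An edge of `M` avoiding this vertex
  -- serves as an intermediary; its ends differ under `B`, so one of them, named `y`, is not in the
  -- class of `i`.
  · obtain ⟨x, y, hxy, hne', hx, hy, hyi⟩ : ∃ x y, s(x, y) ∈ s(i, k) ::ₘ s(j, l) ::ₘ N ∧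
        B x ≠ B y ∧ B x ≠ B k ∧ B y ≠ B k ∧ B y ≠ B i := by
      obtain ⟨x, y, hxy, hne', hx, hy⟩ := exists_pair_avoiding B h hm hij hik (hkl ▸ hjl)
      by_cases hyi : B y = B i
      · exact ⟨y, x, by rwa [Sym2.eq_swap (a := y)], hne'.symm, hy, hx, hyi ▸ hne'⟩
      · exact ⟨x, y, hxy, hne', hx, hy, hyi⟩
    have h1 : s(x, y) ≠ s(i, k) := by
      rw [Ne, Sym2.eq_iff]
      rintro (⟨-, e⟩ | ⟨e, -⟩)
      exacts [hy (e ▸ rfl), hx (e ▸ rfl)]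
    have h2 : s(x, y) ≠ s(j, l) := by
      rw [Ne, Sym2.eq_iff]
      rintro (⟨-, e⟩ | ⟨e, -⟩)
      exacts [hy (e ▸ hkl.symm), hx (e ▸ hkl.symm)]
    obtain ⟨N, rfl⟩ := Multiset.exists_cons_of_mem
      ((Multiset.mem_cons.1 ((Multiset.mem_cons.1 hxy).resolve_left h1)).resolve_left h2)
    -- Replace `ik, yx` by `iy, kx`, then `iy, jl` by `ij, yl`.
    have s1 := swap (s(j, l) ::ₘ N) i k y x hik hne'.symm hyi.symm hx.symm
    have s2 := swap (s(k, x) ::ₘ N) i y j l hyi.symm hjl hij (hkl ▸ hy)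
    refine ⟨_, Multiset.mem_cons_self _ _, trans _ _ _ ?_ s2⟩
    rw [Multiset.cons_swap s(j, l), Multiset.cons_swap s(j, l), Sym2.eq_swap (a := x)]
    exact s1
  · exact ⟨_, Multiset.mem_cons_self _ _, swap N i k j l hik hjl hij hkl⟩

end Multigraph

/-! ### Kernels of monomial homomorphisms. -/

/-- The kernel of a homomorphism sending indeterminates to monomials lies in every ideal which
contains all differences of monomials with the same image. -/
theorem ker_le_of_monomial {σ τ R : Type*} [CommRing R]
    (φ : MvPolynomial σ R →ₐ[R] MvPolynomial τ R)
    (A : (σ →₀ ℕ) → τ →₀ ℕ) (hA : ∀ u, φ (monomial u 1) = monomial (A u) 1)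
    (J : Ideal (MvPolynomial σ R))
    (hJ : ∀ u v, A u = A v → monomial u 1 - monomial v 1 ∈ J) {f : MvPolynomial σ R}
    (hf : φ f = 0) : f ∈ J := by
  -- `L` sends a monomial to the class of some preimage; modulo `J` the choice is irrelevant, so `L
  -- ∘ φ` is the quotient map. The values of `invFun` off the range of `A` play no role.
  let L : MvPolynomial τ R →ₗ[R] MvPolynomial σ R ⧸ J := (basisMonomials τ R).constr R
    fun t => Ideal.Quotient.mk J (monomial (Function.invFun A t) 1)
  have h : L ∘ₗ φ.toLinearMap = (Ideal.Quotient.mkₐ R J).toLinearMap := by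
    refine (basisMonomials σ R).ext fun u => ?_
    have h1 : L (monomial (A u) 1) = Ideal.Quotient.mk J (monomial (Function.invFun A (A u)) 1) := by
      have := (basisMonomials τ R).constr_basis R
        (fun t => Ideal.Quotient.mk J (monomial (Function.invFun A t) 1)) (A u)
      rwa [coe_basisMonomials] at this
    simp only [coe_basisMonomials, LinearMap.comp_apply, AlgHom.toLinearMap_apply, hA, h1,
      Ideal.Quotient.mkₐ_eq_mk]
    rw [Ideal.Quotient.eq]
    exact hJ _ _ (Function.invFun_eq ⟨u, rfl⟩)
  have h2 := LinearMap.congr_fun h f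
  simp only [LinearMap.comp_apply, AlgHom.toLinearMap_apply, hf, map_zero,
    Ideal.Quotient.mkₐ_eq_mk] at h2
  exact Ideal.Quotient.eq_zero_iff_mem.1 h2.symm

end GaussianNetwork

end

noncomputable section

namespace GaussianNetwork

variable {V : Type*} {T : Digraph V} {r : V}

/-! ### Trek monomials, their exponents and the tetrad ideal. -/

theorem Trek.isTop_top (hT : IsAcyclic T) {i j : V} (P : Trek T i j) : P.IsTop P.top :=
  @Classical.epsilon_spec V P.IsTop (existsUnique_isTop hT P).exists

/-- A trek whose top is a leaf is empty. -/
theorem Trek.top_eq_leaf_iff (hT : IsAcyclic T) {i j v : V} (P : Trek T i j)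
    (hv : v ∈ leaves T) : P.top = v ↔ i = v ∧ j = v := by
  have left : ∀ {i j : V} (P : Trek T i j) {c : V}, P.OnLeftSide c → i ∈ descendants T c :=
    fun P c ⟨p, _, _, h⟩ => mem_descendants_of_upward p h
  have h := P.isTop_top hT
  constructor
  · intro he
    rw [he] at h
    exact ⟨eq_of_mem_descendants_leaf hv (left P h.1),
      eq_of_mem_descendants_leaf hv (left P.reverse h.2.reverse)⟩
  · rintro ⟨rfl, rfl⟩
    have hs : P.top ∈ P.1.support := by
      obtain ⟨p, q, hp, -⟩ := h.1
      rw [hp]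
      simp
    have hn : P.1 = .nil :=
      SimpleGraph.Walk.eq_nil_iff_nil.2 (SimpleGraph.Walk.isPath_iff_nil.1 P.2.1)
    rw [hn] at hs
    simpa using hs

/-- The monomial with a given multiset of indeterminates. -/
def mon {σ : Type*} (M : Multiset σ) : MvPolynomial σ ℂ := (M.map X).prod

theorem mon_cons {σ : Type*} (p : σ) (M : Multiset σ) : mon (p ::ₘ M) = X p * mon M := by
  simp [mon]

theorem mon_toMultiset {σ : Type*} (u : σ →₀ ℕ) : mon (Finsupp.toMultiset u) = monomial u 1 := by
  rw [mon, Finsupp.toMultiset_map, Finsupp.prod_toMultiset, monomial_eq, C_1, one_mul,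
    Finsupp.prod_mapDomain_index (by simp) (by simp [pow_add])]

/-- The ideal generated by the tetrads with a choke point. -/
def tetradIdeal (T : Digraph V) : Ideal (MvPolynomial (Sym2 (leaves T)) ℂ) :=
  Ideal.span {f | ∃ i j k l : leaves T,
    (∃ c : V, IsChokePoint T c {(i : V), (j : V)} {(k : V), (l : V)}) ∧ f = tetrad i j k l}

/-- The four inequalities say precisely that `v` separates `{a, d}` from `{b, c}`; nothing is needed
within either pair. This is the `swap` hypothesis of `exists_exchange`. -/
theorem IsRootedDirectedTree.swap_mem (hT : IsRootedDirectedTree T r) {v : V} (hv : v ∉ leaves T)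
    (N : Multiset (Sym2 (leaves T))) (a b c d : leaves T) (hab : branch T v a ≠ branch T v b)
    (hcd : branch T v c ≠ branch T v d) (hac : branch T v a ≠ branch T v c)
    (hbd : branch T v b ≠ branch T v d) :
    mon (s(a, b) ::ₘ s(c, d) ::ₘ N) - mon (s(a, c) ::ₘ s(b, d) ::ₘ N) ∈ tetradIdeal T := by
  have h : tetrad a d b c ∈ tetradIdeal T := Ideal.subset_span ⟨a, d, b, c,
    ⟨v, hT.isChokePoint_of_branch_ne hv a.2 d.2 b.2 c.2 hab hac hbd.symm hcd.symm⟩, rfl⟩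
  have e : mon (s(a, b) ::ₘ s(c, d) ::ₘ N) - mon (s(a, c) ::ₘ s(b, d) ::ₘ N) =
      mon N * tetrad a d b c := by
    simp only [mon_cons, tetrad, Sym2.eq_swap (a := d)]
    ring
  rw [e]
  exact Ideal.mul_mem_left _ _ h

variable [Fintype V]

open Classical in
/-- The product of the `λ_{kl}` over the edges `k → l` of a walk. -/
def edgeMonomial {i j : V} (p : T.toSimpleGraphInclusive.Walk i j) : ParamRing T :=
  ∏ e : Edge T with s(e.1.1, e.1.2) ∈ p.edges, X (Sum.inr e)

theorem trekMonomial_eq {i j : V} (P : Trek T i j) :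
    trekMonomial P = X (Sum.inl P.top) * edgeMonomial P.1 := by
  unfold trekMonomial edgeMonomial
  congr

theorem edgeMonomial_append {i j k : V} (p : T.toSimpleGraphInclusive.Walk i j)
    (q : T.toSimpleGraphInclusive.Walk j k) (h : (p.append q).IsTrail) :
    edgeMonomial (p.append q) = edgeMonomial p * edgeMonomial q := by
  classical
  unfold edgeMonomial
  rw [← Finset.prod_union]
  · refine Finset.prod_congr ?_ fun _ _ => rfl
    ext e
    simp [SimpleGraph.Walk.edges_append]
  · rw [Finset.disjoint_filter]
    intro e _ h1 h2
    have := h.edges_nodup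
    rw [SimpleGraph.Walk.edges_append] at this
    exact (List.nodup_append.1 this).2.2 _ h1 _ h2 rfl

/-- A trek which goes up to `c` factors at `c`. -/
theorem IsRootedDirectedTree.trekMonomial_of_onLeftSide (hT : IsRootedDirectedTree T r)
    {i j c : V} {P : Trek T i j} (h : P.OnLeftSide c) :
    trekMonomial P = edgeMonomial (hT.trek i c).1 * trekMonomial (hT.trek c j) := by
  obtain ⟨p, q, hP, hp⟩ := h
  have hpath : (p.append q).IsPath := hP ▸ P.2.1
  obtain rfl : p = (hT.trek i c).1 := hT.path_unique hpath.of_append_left (hT.trek i c).2.1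
  obtain rfl : q = (hT.trek c j).1 := hT.path_unique hpath.of_append_right (hT.trek c j).2.1
  obtain ⟨⟨q₁, s₁, h₁, hd₁⟩, ⟨q₂, s₂, h₂, hd₂⟩⟩ := (hT.trek c j).isTop_top hT.acyclic
  have htop : P.IsTop (hT.trek c j).top := by
    refine ⟨⟨(hT.trek i c).1.append q₁, s₁, ?_, ?_⟩, ⟨(hT.trek i c).1.append q₂, s₂, ?_, hd₂⟩⟩
    · exact hP.trans ((congrArg _ h₁).trans (SimpleGraph.Walk.append_assoc _ _ _))
    · intro d hd
      rw [SimpleGraph.Walk.darts_append, List.mem_append] at hd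
      exact hd.elim (hp d) (hd₁ d)
    · exact hP.trans ((congrArg _ h₂).trans (SimpleGraph.Walk.append_assoc _ _ _))
  have he : P.top = (hT.trek c j).top :=
    (existsUnique_isTop hT.acyclic P).unique (P.isTop_top hT.acyclic) htop
  rw [trekMonomial_eq, trekMonomial_eq, he, hP, edgeMonomial_append _ _ hpath.isTrail]
  ring

open Classical in
/-- The exponent vector of the monomial of a trek. -/
def trekExponent {i j : V} (P : Trek T i j) : V ⊕ Edge T →₀ ℕ :=
  Finsupp.single (Sum.inl P.top) 1 +
    ∑ e : Edge T with s(e.1.1, e.1.2) ∈ P.1.edges, Finsupp.single (Sum.inr e) 1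

theorem trekMonomial_eq_monomial {i j : V} (P : Trek T i j) :
    trekMonomial P = monomial (trekExponent P) 1 := by
  classical
  rw [trekMonomial_eq, trekExponent, ← mul_one (1 : ℂ), ← monomial_mul, monomial_sum_one]
  unfold edgeMonomial
  congr

open Classical in
theorem trekExponent_inr {i j : V} (P : Trek T i j) (e : Edge T) :
    trekExponent P (Sum.inr e) = if s(e.1.1, e.1.2) ∈ P.1.edges then 1 else 0 := by
  simp [trekExponent, Finsupp.single_apply, Finset.sum_ite_eq']

open Classical in
theorem trekExponent_inl {i j : V} (P : Trek T i j) (v : V) :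
    trekExponent P (Sum.inl v) = if P.top = v then 1 else 0 := by
  simp [trekExponent, Finsupp.single_apply]

/-- The restriction of the trek rule homomorphism to the `σ_{ij}` with `i` and `j` leaves. -/
def observedHom (T : Digraph V) : MvPolynomial (Sym2 (leaves T)) ℂ →ₐ[ℂ] ParamRing T :=
  (trekHom T).comp (rename (Sym2.map ((↑) : leaves T → V)))

theorem IsRootedDirectedTree.observedHom_X (hT : IsRootedDirectedTree T r) (i j : leaves T) :
    observedHom T (X s(i, j)) = trekMonomial (hT.trek i j) := by
  simp [observedHom, trekHom, hT.trekPolynomial_eq]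

theorem IsRootedDirectedTree.observedHom_X_ne_zero (hT : IsRootedDirectedTree T r)
    (p : Sym2 (leaves T)) :
    observedHom T (X p) ≠ 0 ∧ 0 < (observedHom T (X p)).totalDegree := by
  induction p with | _ i j
  have h0 : trekMonomial (hT.trek i j) ≠ 0 := by simp [trekMonomial_eq_monomial]
  rw [hT.observedHom_X]
  refine ⟨h0, ?_⟩
  rw [trekMonomial_eq] at h0 ⊢
  rw [totalDegree_mul_of_isDomain (left_ne_zero_of_mul h0) (right_ne_zero_of_mul h0),
    totalDegree_X]
  omega

open Classical in
theorem IsRootedDirectedTree.exists_exponent (hT : IsRootedDirectedTree T r)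
    (p : Sym2 (leaves T)) : ∃ u, observedHom T (X p) = monomial u 1 ∧
      (∀ e : Edge T, u (Sum.inr e) =
        if Cut ((↑) ⁻¹' descendants T e.1.2 : Set (leaves T)) p then 1 else 0) ∧
      ∀ v : leaves T, u (Sum.inl v) = if p = s(v, v) then 1 else 0 := by
  induction p with | _ i j
  refine ⟨trekExponent (hT.trek i j), ?_, fun e => ?_, fun v => ?_⟩
  · rw [hT.observedHom_X, trekMonomial_eq_monomial]
  · rw [trekExponent_inr]
    refine if_congr ?_ rfl rfl
    rw [hT.mem_edges_iff e.2 (hT.trek i j).2.1.isTrail, cut_mk_iff]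
    rfl
  · rw [trekExponent_inl]
    refine if_congr ?_ rfl rfl
    rw [Trek.top_eq_leaf_iff hT.acyclic _ v.2, Sym2.eq_iff]
    simp [Subtype.ext_iff]

/-- The exponent vector of the image of `σ_p`. -/
def IsRootedDirectedTree.exponent (hT : IsRootedDirectedTree T r) (p : Sym2 (leaves T)) :
    V ⊕ Edge T →₀ ℕ := (hT.exists_exponent p).choose

theorem IsRootedDirectedTree.observedHom_mon (hT : IsRootedDirectedTree T r)
    (M : Multiset (Sym2 (leaves T))) :
    observedHom T (mon M) = monomial (M.map hT.exponent).sum 1 := by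
  induction M using Multiset.induction_on with
  | empty => simp [mon]
  | cons p M ih =>
    rw [mon_cons, map_mul, ih, (hT.exists_exponent p).choose_spec.1, monomial_mul, mul_one,
      Multiset.map_cons, Multiset.sum_cons, exponent]

theorem IsRootedDirectedTree.sum_exponent_eq (hT : IsRootedDirectedTree T r)
    {M M' : Multiset (Sym2 (leaves T))} (h : observedHom T (mon M) = observedHom T (mon M'))
    (x : V ⊕ Edge T) :
    (M.map fun p => hT.exponent p x).sum = (M'.map fun p => hT.exponent p x).sum := by
  rw [hT.observedHom_mon, hT.observedHom_mon] at h
  have h' := DFunLike.congr_fun (monomial_left_injective one_ne_zero h) x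
  have key : ∀ M : Multiset (Sym2 (leaves T)),
      (M.map hT.exponent).sum x = (M.map fun p => hT.exponent p x).sum := by
    intro M
    rw [← Finsupp.applyAddHom_apply, map_multiset_sum, Multiset.map_map]
    rfl
  rwa [key, key] at h'

theorem IsRootedDirectedTree.cutCount_descendants_eq (hT : IsRootedDirectedTree T r)
    {M M' : Multiset (Sym2 (leaves T))} (h : observedHom T (mon M) = observedHom T (mon M'))
    (w : V) : cutCount ((↑) ⁻¹' descendants T w : Set (leaves T)) M =
      cutCount ((↑) ⁻¹' descendants T w : Set (leaves T)) M' := by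
  by_cases hw : w = r
  · have h0 : ∀ M : Multiset (Sym2 (leaves T)),
        cutCount ((↑) ⁻¹' descendants T w : Set (leaves T)) M = 0 := by
      intro M
      refine Multiset.sum_eq_zero fun n hn => ?_
      obtain ⟨q, -, rfl⟩ := Multiset.mem_map.1 hn
      refine if_neg ?_
      rintro ⟨x, -, y, hy, -⟩
      exact hy (by rw [hw]; exact hT.mem_descendants_root _)
    rw [h0, h0]
  · obtain ⟨u, hu⟩ := hT.exists_parent hw
    have he := fun p => (hT.exists_exponent p).choose_spec.2.1 ⟨(u, w), hu⟩
    have := hT.sum_exponent_eq h (Sum.inr ⟨(u, w), hu⟩)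
    simp only [exponent, he] at this
    exact this

theorem IsRootedDirectedTree.loop_mem (hT : IsRootedDirectedTree T r)
    {M M' : Multiset (Sym2 (leaves T))} (h : observedHom T (mon M) = observedHom T (mon M'))
    {i : leaves T} (hi : s(i, i) ∈ M') : s(i, i) ∈ M := by
  classical
  have he := fun p => (hT.exists_exponent p).choose_spec.2.2 i
  have h' := hT.sum_exponent_eq h (Sum.inl i)
  simp only [exponent, he] at h'
  by_contra hn
  rw [Multiset.sum_eq_zero (s := M.map _)] at h'
  · have := Multiset.sum_eq_zero_iff.1 h'.symm _ (Multiset.mem_map_of_mem _ hi)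
    simp at this
  · intro n hn'
    obtain ⟨q, hq, rfl⟩ := Multiset.mem_map.1 hn'
    exact if_neg (by rintro rfl; exact hn hq)

theorem IsRootedDirectedTree.cutCount_branch_eq (hT : IsRootedDirectedTree T r)
    {M M' : Multiset (Sym2 (leaves T))} (h : observedHom T (mon M) = observedHom T (mon M'))
    {v : V} (hv : v ∉ leaves T) (b : V) :
    cutCount ((fun x : leaves T => branch T v x) ⁻¹' {b}) M =
      cutCount ((fun x : leaves T => branch T v x) ⁻¹' {b}) M' := by
  classical
  have congr_cut : ∀ {S S' : Set (leaves T)}, (∀ p, Cut S p ↔ Cut S' p) →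
      cutCount S' M = cutCount S' M' → cutCount S M = cutCount S M' := by
    intro S S' hS h
    unfold cutCount at *
    rwa [show Cut S = Cut S' from funext fun p => propext (hS p)]
  by_cases hb : T.Adj v b
  · refine congr_cut (fun p => ?_) (hT.cutCount_descendants_eq h b)
    induction p with | _ x y
    simp [cut_mk_iff, hT.branch_eq_iff hb]
  -- The fiber over `v` is the complement of the leaves below `v`, which has the same cuts. Any
  -- other fiber is empty and, like the set of all leaves below `r`, cuts nothing.
  · refine congr_cut (fun p => ?_) (hT.cutCount_descendants_eq h (if b = v then v else r))
    induction p with | _ x y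
    split_ifs with hbv
    · subst hbv
      simp only [cut_mk_iff, Set.mem_preimage, Set.mem_singleton_iff,
        branch_eq_self_iff_of_leaf hT.acyclic hv (Subtype.mem _)]
      tauto
    · have hne : ∀ x, branch T v x ≠ b := by
        rintro x rfl
        exact (branch_eq_self_or_adj v x).elim hbv hb
      simp [cut_mk_iff, hne, hT.mem_descendants_root]

/-- Splitting each trek at `c` writes its monomial as a factor depending on `x` times a factor
depending on `y`, so the tetrad becomes a minor of a matrix of rank one. -/
theorem IsRootedDirectedTree.observedHom_tetrad (hT : IsRootedDirectedTree T r)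
    {i j k l : leaves T} {c : V} (hc : ∀ x ∈ ({(i : V), (j : V)} : Set V),
      ∀ y ∈ ({(k : V), (l : V)} : Set V), ∀ P : Trek T x y, P.OnLeftSide c) :
    observedHom T (tetrad i j k l) = 0 := by
  have h : ∀ x y : leaves T, (x : V) ∈ ({(i : V), (j : V)} : Set V) →
      (y : V) ∈ ({(k : V), (l : V)} : Set V) → observedHom T (X s(x, y)) =
        edgeMonomial (hT.trek x c).1 * trekMonomial (hT.trek c y) := fun x y hx hy => by
    rw [hT.observedHom_X, hT.trekMonomial_of_onLeftSide (hc x hx y hy _)]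
  rw [tetrad, Sym2.eq_swap (a := k), map_sub, map_mul, map_mul, h i k, h j l, h i l, h j k]
  · ring
  all_goals simp

theorem IsRootedDirectedTree.tetradIdeal_le (hT : IsRootedDirectedTree T r) :
    tetradIdeal T ≤ observedIdeal T (leaves T) := by
  refine Ideal.span_le.2 ?_
  rintro f ⟨i, j, k, l, ⟨c, -, hc | hc⟩, rfl⟩
  · exact hT.observedHom_tetrad hc
  -- Reversing the treks reduces the right-side case to the left-side one.
  · have h : tetrad i j k l = tetrad k l i j := by
      simp only [tetrad, Sym2.eq_swap (a := k), Sym2.eq_swap (a := l)]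
      ring
    rw [h]
    refine hT.observedHom_tetrad (c := c) fun x hx y hy P => ?_
    simpa only [Trek.reverse_reverse] using (hc y hy x hx P.reverse).reverse

/-! ### Connecting monomials with equal image by tetrads. -/

/-- If a pair of `M'` has both ends below `v` and no pair of `M + M'` has both ends below a child
of `v`, then `M` can be changed by tetrads so as to contain this pair. -/
theorem IsRootedDirectedTree.exists_tetrad_equiv (hT : IsRootedDirectedTree T r)
    {M M' : Multiset (Sym2 (leaves T))} (h : observedHom T (mon M) = observedHom T (mon M'))
    {v : V} {i j : leaves T} (hij : i ≠ j) (hm : s(i, j) ∈ M')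
    (hi : (i : V) ∈ descendants T v) (hj : (j : V) ∈ descendants T v)
    (hmin : ∀ w, T.Adj v w → ∀ x y : leaves T, x ≠ y → s(x, y) ∈ M + M' →
      (x : V) ∈ descendants T w → (y : V) ∉ descendants T w) :
    ∃ N, s(i, j) ∈ N ∧ mon M - mon N ∈ tetradIdeal T := by
  have hv : v ∉ leaves T := fun hv => hij (Subtype.ext
    ((eq_of_mem_descendants_leaf hv hi).trans (eq_of_mem_descendants_leaf hv hj).symm))
  have hne : ∀ x y : leaves T, x ≠ y → s(x, y) ∈ M + M' → (x : V) ∈ descendants T v →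
      branch T v x ≠ branch T v y := by
    intro x y hxy hm hx he
    rcases branch_eq_self_or_adj (T := T) v x with hb | hb
    · exact (branch_eq_self_iff_of_leaf hT.acyclic hv x.2).1 hb hx
    · exact hmin _ hb x y hxy hm ((hT.branch_eq_iff hb).1 rfl) ((hT.branch_eq_iff hb).1 he.symm)
  have hpartner : ∀ x y : leaves T, x ≠ y → s(x, y) ∈ M' → (x : V) ∈ descendants T v →
      ∃ k, s(x, k) ∈ M ∧ branch T v x ≠ branch T v k := by
    intro x y hxy hm hx
    -- Only `x` itself lies below the leaf `x`, so the cut count there is the number of non-loop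
    -- pairs at `x`; as `M'` has one, so does `M`.
    obtain ⟨q, hq, a, ha, b, hb, rfl⟩ := exists_cut_of_cutCount_eq
      (hT.cutCount_descendants_eq h x) hm (cut_mk_iff.2 (by
        have : (y : V) ∉ descendants T x := fun hy =>
          hxy (Subtype.ext (eq_of_mem_descendants_leaf x.2 hy).symm)
        simpa [this] using self_mem_descendants _))
    obtain rfl : a = x := Subtype.ext (eq_of_mem_descendants_leaf x.2 ha)
    have hab : a ≠ b := by rintro rfl; exact hb ha
    exact ⟨b, hq, hne a b hab (Multiset.mem_add.2 (Or.inl hq)) hx⟩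
  obtain ⟨k, hk, hik⟩ := hpartner i j hij hm hi
  obtain ⟨l, hl, hjl⟩ := hpartner j i hij.symm (Sym2.eq_swap ▸ hm) hj
  refine exists_exchange (fun x : leaves T => branch T v x) (hT.cutCount_branch_eq h hv) hm
    (hne i j hij (Multiset.mem_add.2 (Or.inr hm)) hi) hk hik hl hjl
    (fun M N => mon M - mon N ∈ tetradIdeal T) (by simp) ?_ (hT.swap_mem hv)
  intro M N K h1 h2
  simpa using Ideal.add_mem _ h1 h2

/-- Two monomials with the same image can be changed by tetrads so as to have a common factor. -/
theorem IsRootedDirectedTree.exists_common_factor (hT : IsRootedDirectedTree T r)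
    {M M' : Multiset (Sym2 (leaves T))} (h : observedHom T (mon M) = observedHom T (mon M'))
    (h0 : M + M' ≠ 0) : ∃ p N N', mon M - mon (p ::ₘ N) ∈ tetradIdeal T ∧
      mon M' - mon (p ::ₘ N') ∈ tetradIdeal T := by
  have of_mem : ∀ {M M' : Multiset (Sym2 (leaves T))} {p}, p ∈ M' →
      (∃ N, p ∈ N ∧ mon M - mon N ∈ tetradIdeal T) → ∃ p N N',
        mon M - mon (p ::ₘ N) ∈ tetradIdeal T ∧ mon M' - mon (p ::ₘ N') ∈ tetradIdeal T := by
    rintro M M' p hp ⟨N, hN, hMN⟩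
    obtain ⟨N, rfl⟩ := Multiset.exists_cons_of_mem hN
    obtain ⟨N', rfl⟩ := Multiset.exists_cons_of_mem hp
    exact ⟨p, N, N', hMN, by simp⟩
  by_cases hloop : ∃ i, s(i, i) ∈ M + M'
  · obtain ⟨i, hi⟩ := hloop
    have hM' : s(i, i) ∈ M' := (Multiset.mem_add.1 hi).elim (hT.loop_mem h.symm) id
    exact of_mem hM' ⟨M, hT.loop_mem h hM', by simp⟩
  · let S : Set V := {v | ∃ i j : leaves T, i ≠ j ∧ s(i, j) ∈ M + M' ∧
      (i : V) ∈ descendants T v ∧ (j : V) ∈ descendants T v}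
    have hS : S.Nonempty := by
      obtain ⟨p, hp⟩ := Multiset.exists_mem_of_ne_zero h0
      induction p with | _ i j
      refine ⟨r, i, j, ?_, hp, hT.mem_descendants_root _, hT.mem_descendants_root _⟩
      rintro rfl
      exact hloop ⟨i, hp⟩
    -- A child has strictly fewer descendants, so minimality excludes pairs below any child of `v`.
    obtain ⟨v, ⟨i, j, hij, hm, hi, hj⟩, hmin⟩ :=
      Set.exists_min_image S (fun v => (descendants T v).ncard) (Set.toFinite _) hS
    have hmin' : ∀ w, T.Adj v w → ∀ x y : leaves T, x ≠ y → s(x, y) ∈ M + M' →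
        (x : V) ∈ descendants T w → (y : V) ∉ descendants T w := by
      intro w hw x y hxy hm hx hy
      refine (hmin w ⟨x, y, hxy, hm, hx, hy⟩).not_gt (Set.ncard_lt_ncard ?_ (Set.toFinite _))
      exact (descendants_subset
        (mem_descendants_of_adj (self_mem_descendants v) hw)).ssubset_of_mem_notMem
        (self_mem_descendants v) (hT.acyclic.notMem_descendants hw)
    rcases Multiset.mem_add.1 hm with hm | hm
    · obtain ⟨p, N, N', h1, h2⟩ := of_mem hm
        (hT.exists_tetrad_equiv h.symm hij hm hi hj (by rwa [add_comm]))
      exact ⟨p, N', N, h2, h1⟩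
    · exact of_mem hm (hT.exists_tetrad_equiv h hij hm hi hj hmin')

theorem IsRootedDirectedTree.mon_sub_mon_mem (hT : IsRootedDirectedTree T r)
    {M M' : Multiset (Sym2 (leaves T))} (h : observedHom T (mon M) = observedHom T (mon M')) :
    mon M - mon M' ∈ tetradIdeal T := by
  -- The degree of the image is unchanged by tetrads and drops when a common `σ_p` is cancelled, so
  -- the sizes of the multisets need not be tracked.
  induction hn : (observedHom T (mon M)).totalDegree using Nat.strong_induction_on
    generalizing M M' with | _ n ih
  by_cases h0 : M + M' = 0
  · obtain ⟨rfl, rfl⟩ := add_eq_zero.1 h0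
    simp
  · obtain ⟨p, N, N', h1, h2⟩ := hT.exists_common_factor h h0
    have e1 : observedHom T (mon M) = observedHom T (X p) * observedHom T (mon N) := by
      rw [← map_mul, ← mon_cons, ← sub_eq_zero, ← map_sub]
      exact hT.tetradIdeal_le h1
    have e2 : observedHom T (mon M') = observedHom T (X p) * observedHom T (mon N') := by
      rw [← map_mul, ← mon_cons, ← sub_eq_zero, ← map_sub]
      exact hT.tetradIdeal_le h2
    obtain ⟨hp, hdeg⟩ := hT.observedHom_X_ne_zero p
    have hN : observedHom T (mon N) ≠ 0 := by
      rw [hT.observedHom_mon]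
      simp
    have h3 := ih _ (by rw [← hn, e1, totalDegree_mul_of_isDomain hp hN]; omega)
      (mul_left_cancel₀ hp (e1.symm.trans (h.trans e2))) rfl
    have h4 : mon M - mon M' = (mon M - mon (p ::ₘ N)) - (mon M' - mon (p ::ₘ N')) +
        X p * (mon N - mon N') := by
      rw [mon_cons, mon_cons]
      ring
    rw [h4]
    exact Ideal.add_mem _ (Ideal.sub_mem _ h1 h2) (Ideal.mul_mem_left _ _ h3)

theorem IsRootedDirectedTree.observedIdeal_eq (hT : IsRootedDirectedTree T r) :
    observedIdeal T (leaves T) = tetradIdeal T := by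
  refine le_antisymm (fun f hf => ?_) hT.tetradIdeal_le
  refine ker_le_of_monomial (observedHom T)
    (fun u => ((Finsupp.toMultiset u).map hT.exponent).sum) (fun u => ?_) _ (fun u u' h => ?_) hf
  · rw [← mon_toMultiset, hT.observedHom_mon]
  · rw [← mon_toMultiset, ← mon_toMultiset]
    refine hT.mon_sub_mon_mem ?_
    rw [hT.observedHom_mon, hT.observedHom_mon, h]

end GaussianNetwork

end

theorem mainTheorem3 {V : Type*} [Fintype V] (T : Digraph V) (r : V)
    (hT : GaussianNetwork.IsRootedDirectedTree T r) :
    GaussianNetwork.observedIdeal T (GaussianNetwork.leaves T) =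
      Ideal.span {f | ∃ i j k l : GaussianNetwork.leaves T,
        (∃ c : V, GaussianNetwork.IsChokePoint T c {(i : V), (j : V)} {(k : V), (l : V)}) ∧
          f = GaussianNetwork.tetrad i j k l} := by
  exact hT.observedIdeal_eq
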